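/- Throughout, $\log$ is the logarithm to base $2$. Let $U=[n]$ and let $p_1,\dots,p_n\in[0,1]$. A decision tree $\mathcal T$ over $U$ is a finite rooted binary tree in which every internal node $v$ represents an element $\mathsf{elt}(v)\in U$ and has one Yes arc and one No arc, and in which no element is represented by two different nodes of the same root-to-leaf path; leaves represent no element. For a set $S$ of internal nodes write $\mathsf{elt}(S)=\{\mathsf{elt}(v):v\in S\}$. For a leaf $\ell$, let $P_\ell$ be the set of internal nodes on the path from the root to $\ell$, and let $A_\ell\subseteq P_\ell$ be the set of those nodes of $P_\ell$ whose Yes arc is taken on this path. Let $\pi_{\mathcal T}$ be the distribution of the leaf reached from the root when at each internal node $v$ the Yes arc is followed with probability $p_{\mathsf{elt}(v)}$ and the No arc otherwise. Let $\mathbb P_R$ be the distribution of the random set $R$ of internal nodes obtained as follows: independently for each $e\in U$, with probability $p_e$ all nodes $v$ with $\mathsf{elt}(v)=e$ belong to $R$, and with probability $1-p_e$ none of them does. **Theorem.** There is an absolute constant $N$ such that the following holds for all $n\ge N$, all $p_1,\dots,p_n\in[0,1]$ and all decision trees $\mathcal T$ over $[n]$. Let $A'_\ell\subseteq A_\ell$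 be an arbitrary subset for every leaf $\ell$ of $\mathcal T$, put $f_{\mathrm{xos}}(S)=\max_{\ell}|\mathsf{elt}(A'_\ell)\cap S|$ for $S\subseteq U$, the maximum being over all leaves, and put $$K=50\left\lceil\frac{\log n}{\log\log n}\right\rceil+50 .$$ If $\mathbb E_{\ell\leftarrow\pi_{\mathcal T}}\bigl[|A'_\ell|\bigr]\ge 6K$, then $$\mathbb E_{\ell\leftarrow\pi_{\mathcal T}}\Bigl[\mathbb E_{R\sim\mathbb P_R}\bigl[f_{\mathrm{xos}}(\mathsf{elt}(R\cap P_\ell))\bigr]\Bigr]\ \ge\ \frac{1}{6K}\,\mathbb E_{\ell\leftarrow\pi_{\mathcal T}}\bigl[|A'_\ell|\bigr].$$ -/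

import Mathlib

/-- An adaptive strategy tree over the ground set `U = Fin n`: every internal node represents an
element of `U` and has a `Yes` arc and a `No` arc; a leaf only signals termination. -/
inductive DecisionTree (n : ℕ) : Type
  | leaf : DecisionTree n
  | node (e : Fin n) (yes no : DecisionTree n) : DecisionTree n

namespace DecisionTree

/-- The leaves of a tree, given by the sequence of arcs taken from the root. -/
inductive Leaf {n : ℕ} : DecisionTree n → Type
  | here : Leaf DecisionTree.leaf
  | yes {e : Fin n} {t₁ t₀ : DecisionTree n} (l : Leaf t₁) : Leaf (DecisionTree.node e t₁ t₀)
  | no {e : Fin n} {t₁ t₀ : DecisionTree n} (l : Leaf t₀) : Leaf (DecisionTree.node e t₁ t₀)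
  deriving DecidableEq

/-- The internal nodes of a tree (those that represent an element): the root, or an internal node
of the `Yes` subtree, or one of the `No` subtree. Distinct nodes may represent the same element. -/
inductive Node {n : ℕ} : DecisionTree n → Type
  | root {e : Fin n} {t₁ t₀ : DecisionTree n} : Node (DecisionTree.node e t₁ t₀)
  | inYes {e : Fin n} {t₁ t₀ : DecisionTree n} (v : Node t₁) : Node (DecisionTree.node e t₁ t₀)
  | inNo {e : Fin n} {t₁ t₀ : DecisionTree n} (v : Node t₀) : Node (DecisionTree.node e t₁ t₀)
  deriving DecidableEq

variable {n : ℕ}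

instance instFintypeLeaf : (T : DecisionTree n) → Fintype (Leaf T)
  | .leaf => ⟨{Leaf.here}, by intro l; cases l; simp⟩
  | .node e t₁ t₀ =>
    letI := instFintypeLeaf t₁
    letI := instFintypeLeaf t₀
    Fintype.ofEquiv (Leaf t₁ ⊕ Leaf t₀)
      { toFun := Sum.elim Leaf.yes Leaf.no
        invFun := fun l => match l with
          | .yes l => Sum.inl l
          | .no l => Sum.inr l
        left_inv := by rintro (l | l) <;> rfl
        right_inv := by intro l; cases l <;> rfl }

instance instFintypeNode : (T : DecisionTree n) → Fintype (Node T)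
  | .leaf => ⟨∅, by intro v; cases v⟩
  | .node e t₁ t₀ =>
    letI := instFintypeNode t₁
    letI := instFintypeNode t₀
    Fintype.ofEquiv (Option (Node t₁ ⊕ Node t₀))
      { toFun := fun o => match o with
          | none => Node.root
          | some (.inl v) => Node.inYes v
          | some (.inr v) => Node.inNo v
        invFun := fun v => match v with
          | .root => none
          | .inYes v => some (Sum.inl v)
          | .inNo v => some (Sum.inr v)
        left_inv := by rintro (_ | v | v) <;> rfl
        right_inv := by intro v; cases v <;> rfl }

/-- The element `elt(v)` represented by an internal node `v`. -/
def elt : {T : DecisionTree n} → Node T → Fin n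
  | .node e _ _, .root => e
  | .node _ _ _, .inYes v => elt v
  | .node _ _ _, .inNo v => elt v

/-- `elt(S) = {elt(v) : v ∈ S}` for a set `S` of internal nodes. -/
def eltSet {T : DecisionTree n} (S : Finset (Node T)) : Finset (Fin n) :=
  S.image elt

/-- The set `P_ℓ` of internal nodes visited on the way from the root to the leaf `ℓ`. -/
def path : {T : DecisionTree n} → Leaf T → Finset (Node T)
  | .leaf, .here => ∅
  | .node _ _ _, .yes l => insert Node.root ((path l).image Node.inYes)
  | .node _ _ _, .no l => insert Node.root ((path l).image Node.inNo)

/-- The set `A_ℓ` of active ancestors of the leaf `ℓ`: the nodes of `P_ℓ` whose `Yes` arc is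
taken on the way from the root to `ℓ`. -/
def active : {T : DecisionTree n} → Leaf T → Finset (Node T)
  | .leaf, .here => ∅
  | .node _ _ _, .yes l => insert Node.root ((active l).image Node.inYes)
  | .node _ _ _, .no l => (active l).image Node.inNo

/-- No element is represented by more than one node on any root-to-leaf path. -/
def PathsDistinct (T : DecisionTree n) : Prop :=
  ∀ l : Leaf T, ∀ u ∈ path l, ∀ v ∈ path l, elt u = elt v → u = v

/-- The probability `π_T(ℓ)` of reaching the leaf `ℓ` when, at each node `v`, the `Yes` arc is
followed with probability `p (elt v)` and the `No` arc with probability `1 - p (elt v)`. -/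
def leafProb (p : Fin n → ℝ) : {T : DecisionTree n} → Leaf T → ℝ
  | .leaf, .here => 1
  | .node e _ _, .yes l => p e * leafProb p l
  | .node e _ _, .no l => (1 - p e) * leafProb p l

/-- The expectation of `g ℓ` over a random leaf `ℓ ← π_T`. -/
def leafExp (p : Fin n → ℝ) {T : DecisionTree n} (g : Leaf T → ℝ) : ℝ :=
  ∑ l : Leaf T, leafProb p l * g l

/-- The probability that `X` is exactly the set of active elements, when each element `e` is
active independently with probability `p e`. -/
def activeProb (p : Fin n → ℝ) (X : Finset (Fin n)) : ℝ :=
  (∏ e ∈ X, p e) * ∏ e ∈ Xᶜ, (1 - p e)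

/-- The set of all nodes of the tree that represent an element of `X`. -/
def nodesOf (T : DecisionTree n) (X : Finset (Fin n)) : Finset (Node T) :=
  Finset.univ.filter fun v => elt v ∈ X

/-- The expectation of `g R` over a random set `R ∼ ℙ_R` of nodes: independently for each element
`e`, with probability `p e` all nodes representing `e` are in `R`, otherwise none of them is. -/
def nodeSetExp (p : Fin n → ℝ) {T : DecisionTree n} (g : Finset (Node T) → ℝ) : ℝ :=
  ∑ X : Finset (Fin n), activeProb p X * g (nodesOf T X)

/-- The expected reward of the non-adaptive strategy derived from `T`: draw a leaf `ℓ ← π_T`,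
probe all the elements on `P_ℓ` afresh and receive `f (elt (R ∩ P_ℓ))`. -/
def nadp (p : Fin n → ℝ) (T : DecisionTree n) (f : Finset (Fin n) → ℝ) : ℝ :=
  leafExp p fun l : Leaf T => nodeSetExp p fun R => f (eltSet (R ∩ path l))

/-- `f_xos(S) = max_ℓ |elt(A'_ℓ) ∩ S|`, the maximum being over the (finitely many, at least one)
leaves of `T`. -/
def fXos {T : DecisionTree n} (A' : Leaf T → Finset (Node T)) (S : Finset (Fin n)) : ℕ :=
  Finset.univ.sup fun l : Leaf T => (eltSet (A' l) ∩ S).card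

end DecisionTree

/-- `K = 50 ⌈log n / log log n⌉ + 50`, with logarithms to base `2`. -/
noncomputable def probingK (n : ℕ) : ℕ :=
  50 * ⌈Real.logb 2 n / Real.logb 2 (Real.logb 2 n)⌉₊ + 50

/-! Let F be the family of sets elt(A'_ℓ), with rank r_F(X) = max |S ∩ X| over S in F. Walk down the
tree with visited elements P and active ones A, and follow the potential exp(α r_F(A) − β E r_F(X ∩
P)), where X is a fresh random active set. At an element e, compare the expected marginal gain g of
e over X ∩ P with 1/2.

If g ≥ 1/2, the growth of the β-term pays for the possible increase of r_F(A), and the potential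
does not grow in expectation (`potential_step_of_half_le_gain`). If g < 1/2, the link of e has
expected rank on P at least 1/2 below that of F (when e is covered), while an increase of r_F(A)
must come from a set containing e. The loss is then at most exp(α − β/2) times the potential of the
link (`potential_step_of_gain_lt_half`).

Summed along the walk, the final expected potential is at most 1 plus one such term per element
(`walkExp_potential_le`). Links have smaller sets, so with exp(α − β/2) ≤ 1/(2n) induction on set
size keeps the bound 2 at every level. Since exp y ≥ 1 + y, this gives α E|A'_ℓ| ≤ β · `nadp` + 1.
Taking α = ln ln n and β of order ln n gives a gap of order log n / log log n. -/

open Finset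

namespace DecisionTree

variable {n : ℕ}

/-! ### Expectations over a random set of active elements -/

/-- The expectation of `g X` when `X` is the random set of active elements. -/
noncomputable def setExp (p : Fin n → ℝ) (g : Finset (Fin n) → ℝ) : ℝ :=
  ∑ X : Finset (Fin n), activeProb p X * g X

theorem activeProb_nonneg {p : Fin n → ℝ} (hp : ∀ i, 0 ≤ p i ∧ p i ≤ 1) (X : Finset (Fin n)) :
    0 ≤ activeProb p X :=
  mul_nonneg (prod_nonneg fun i _ => (hp i).1)
    (prod_nonneg fun i _ => sub_nonneg.2 (hp i).2)

theorem sum_activeProb (p : Fin n → ℝ) : ∑ X : Finset (Fin n), activeProb p X = 1 := by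
  have h := Finset.prod_add p (fun i => 1 - p i) (univ : Finset (Fin n))
  simp only [add_sub_cancel, prod_const_one, powerset_univ] at h
  rw [h]
  exact sum_congr rfl fun X _ => by rw [activeProb, compl_eq_univ_sdiff]

theorem setExp_const (p : Fin n → ℝ) (c : ℝ) : setExp p (fun _ => c) = c := by
  rw [setExp, ← sum_mul, sum_activeProb, one_mul]

theorem setExp_add (p : Fin n → ℝ) (g h : Finset (Fin n) → ℝ) :
    setExp p (fun X => g X + h X) = setExp p g + setExp p h := by
  simp only [setExp, mul_add, sum_add_distrib]

theorem setExp_mono {p : Fin n → ℝ} (hp : ∀ i, 0 ≤ p i ∧ p i ≤ 1) {g h : Finset (Fin n) → ℝ}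
    (hgh : ∀ X, g X ≤ h X) : setExp p g ≤ setExp p h :=
  sum_le_sum fun X _ => mul_le_mul_of_nonneg_left (hgh X) (activeProb_nonneg hp X)

theorem sum_finset_split (e : Fin n) (g : Finset (Fin n) → ℝ) :
    ∑ X : Finset (Fin n), g X =
      ∑ Y ∈ (univ.erase e).powerset, g Y + ∑ Y ∈ (univ.erase e).powerset, g (insert e Y) := by
  rw [← sum_powerset_insert (notMem_erase e univ), insert_erase (mem_univ e), powerset_univ]

/-- Whether `e` is active is independent of the other elements. -/
theorem setExp_split (p : Fin n → ℝ) (e : Fin n) (g : Finset (Fin n) → ℝ) :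
    setExp p g = p e * setExp p (fun X => g (insert e X)) +
      (1 - p e) * setExp p (fun X => g (X.erase e)) := by
  have h1 : ∀ Y ∈ (univ.erase e : Finset (Fin n)).powerset,
      activeProb p (insert e Y) * (1 - p e) = activeProb p Y * p e := by
    intro Y hY
    have he : e ∉ Y := fun h => by simpa using mem_powerset.1 hY h
    have hc : Yᶜ = insert e (insert e Y)ᶜ := by
      ext x
      by_cases hx : x = e <;> simp [hx, he]
    rw [activeProb, activeProb, prod_insert he, hc, prod_insert (by simp)]
    ring
  -- Conditional probability of e given the other elements, written without division so that null
  -- events need no separate treatment.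
  have h2 : ∀ Y ∈ (univ.erase e : Finset (Fin n)).powerset,
      activeProb p (insert e Y) = (activeProb p Y + activeProb p (insert e Y)) * p e := by
    intro Y hY
    linear_combination h1 Y hY
  have h3 : ∀ Y ∈ (univ.erase e : Finset (Fin n)).powerset, Y.erase e = Y :=
    fun Y hY => erase_eq_of_notMem fun h => by simpa using mem_powerset.1 hY h
  simp only [setExp]
  rw [sum_finset_split e, sum_finset_split e (fun X => activeProb p X * g (insert e X)),
    sum_finset_split e (fun X => activeProb p X * g (X.erase e)), ← sum_add_distrib,
    ← sum_add_distrib, ← sum_add_distrib, mul_sum, mul_sum, ← sum_add_distrib]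
  refine sum_congr rfl fun Y hY => ?_
  have hi : (insert e Y).erase e = Y := by
    rw [erase_insert_eq_erase, h3 Y hY]
  rw [insert_idem, hi, h3 Y hY]
  linear_combination (g (insert e Y) - g Y) * h2 Y hY

/-! ### The rank function of a set family -/

/-- `max_{S ∈ F} |S ∩ X|`. -/
def famRank (F : Finset (Finset (Fin n))) (X : Finset (Fin n)) : ℕ :=
  F.sup fun S => (S ∩ X).card

/-- The link of `e`: the sets of `F` containing `e`, with `e` removed. -/
def link (F : Finset (Finset (Fin n))) (e : Fin n) : Finset (Finset (Fin n)) :=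
  (F.filter fun S => e ∈ S).image fun S => S.erase e

theorem card_inter_le_famRank {F : Finset (Finset (Fin n))} {S : Finset (Fin n)} (hS : S ∈ F)
    (X : Finset (Fin n)) : (S ∩ X).card ≤ famRank F X :=
  le_sup (f := fun S => (S ∩ X).card) hS

theorem famRank_mono (F : Finset (Finset (Fin n))) {X Y : Finset (Fin n)} (h : X ⊆ Y) :
    famRank F X ≤ famRank F Y :=
  Finset.sup_mono_fun fun _ _ => card_le_card (inter_subset_inter_left h)

theorem famRank_empty (F : Finset (Finset (Fin n))) : famRank F ∅ = 0 := by
  simp [famRank]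

theorem famRank_insert_le_succ (F : Finset (Finset (Fin n))) (e : Fin n) (X : Finset (Fin n)) :
    famRank F (insert e X) ≤ famRank F X + 1 := by
  refine Finset.sup_le fun S hS => ?_
  have h1 : S ∩ insert e X ⊆ insert e (S ∩ X) := by
    intro x
    simp only [mem_inter, mem_insert]
    tauto
  exact ((card_le_card h1).trans (card_insert_le _ _)).trans
    (Nat.succ_le_succ (card_inter_le_famRank hS X))

theorem famRank_insert_of_not_covered {F : Finset (Finset (Fin n))} {e : Fin n}
    (h : ∀ S ∈ F, e ∉ S) (X : Finset (Fin n)) : famRank F (insert e X) ≤ famRank F X :=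
  Finset.sup_le fun S hS => by
    rw [inter_insert_of_notMem (h S hS)]
    exact card_inter_le_famRank hS X

/-- A maximising set either avoids e or comes from the link. -/
theorem famRank_insert_le_max (F : Finset (Finset (Fin n))) (e : Fin n) (X : Finset (Fin n)) :
    famRank F (insert e X) ≤ max (famRank F X) (famRank (link F e) X + 1) := by
  refine Finset.sup_le fun S hS => ?_
  by_cases he : e ∈ S
  · have hl : S.erase e ∈ link F e := mem_image.2 ⟨S, mem_filter.2 ⟨hS, he⟩, rfl⟩
    have h1 : S ∩ insert e X ⊆ insert e (S.erase e ∩ X) := by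
      intro x
      simp only [mem_inter, mem_insert, mem_erase]
      tauto
    exact (((card_le_card h1).trans (card_insert_le _ _)).trans
      (Nat.succ_le_succ (card_inter_le_famRank hl X))).trans (le_max_right _ _)
  · rw [inter_insert_of_notMem he]
    exact (card_inter_le_famRank hS X).trans (le_max_left _ _)

/-- Restore e to an optimal set of the link. Some set must contain e: an empty link has rank 0 by
convention, and the bound could fail. -/
theorem famRank_link_succ_le {F : Finset (Finset (Fin n))} {e : Fin n} (h : ∃ S ∈ F, e ∈ S)
    (X : Finset (Fin n)) : famRank (link F e) X + 1 ≤ famRank F (insert e X) := by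
  obtain ⟨S₀, hS₀, he₀⟩ := h
  have hne : (link F e).Nonempty :=
    ⟨S₀.erase e, mem_image.2 ⟨S₀, mem_filter.2 ⟨hS₀, he₀⟩, rfl⟩⟩
  obtain ⟨S', hS', hmax⟩ := exists_mem_eq_sup (link F e) hne fun S => (S ∩ X).card
  obtain ⟨S, hS, rfl⟩ := mem_image.1 hS'
  obtain ⟨hSF, he⟩ := mem_filter.1 hS
  rw [famRank, hmax, ← card_insert_of_notMem (s := S.erase e ∩ X) (a := e) (by simp)]
  refine (card_le_card fun x => ?_).trans (card_inter_le_famRank hSF _)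
  simp only [mem_inter, mem_insert, mem_erase]
  rintro (rfl | ⟨⟨_, hx⟩, hX⟩)
  · exact ⟨he, Or.inl rfl⟩
  · exact ⟨hx, Or.inr hX⟩

/-- The expected rank of the active elements of `P`. -/
noncomputable def expRank (p : Fin n → ℝ) (F : Finset (Finset (Fin n))) (P : Finset (Fin n)) : ℝ :=
  setExp p fun X => (famRank F (X ∩ P) : ℝ)

/-- The expected increase of the rank of the active elements of `P` when `e` is added. -/
noncomputable def gain (p : Fin n → ℝ) (F : Finset (Finset (Fin n))) (e : Fin n)
    (P : Finset (Fin n)) : ℝ :=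
  setExp p (fun X => (famRank F (insert e (X ∩ P)) : ℝ)) - expRank p F P

theorem expRank_empty (p : Fin n → ℝ) (F : Finset (Finset (Fin n))) : expRank p F ∅ = 0 := by
  simp only [expRank, inter_empty, famRank_empty, Nat.cast_zero]
  exact setExp_const p 0

theorem gain_nonneg {p : Fin n → ℝ} (hp : ∀ i, 0 ≤ p i ∧ p i ≤ 1) (F : Finset (Finset (Fin n)))
    (e : Fin n) (P : Finset (Fin n)) : 0 ≤ gain p F e P :=
  sub_nonneg.2 (setExp_mono hp fun _ => by exact_mod_cast famRank_mono F (subset_insert _ _))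

/-- As e is outside P, its activity is independent of X ∩ P, so the gain is collected with
probability p e. -/
theorem expRank_insert (p : Fin n → ℝ) (F : Finset (Finset (Fin n))) {e : Fin n}
    {P : Finset (Fin n)} (he : e ∉ P) :
    expRank p F (insert e P) = expRank p F P + p e * gain p F e P := by
  have h1 : ∀ X : Finset (Fin n), insert e X ∩ insert e P = insert e (X ∩ P) := fun X =>
    (insert_inter_distrib X P e).symm
  have h2 : ∀ X : Finset (Fin n), X.erase e ∩ insert e P = X ∩ P := by
    intro X
    ext x
    by_cases hx : x = e <;> simp [hx, he]
  rw [expRank, setExp_split p e]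
  simp only [h1, h2]
  rw [gain, expRank]
  ring

theorem expRank_link_le {p : Fin n → ℝ} (hp : ∀ i, 0 ≤ p i ∧ p i ≤ 1)
    {F : Finset (Finset (Fin n))} {e : Fin n} (h : ∃ S ∈ F, e ∈ S) (P : Finset (Fin n)) :
    expRank p (link F e) P ≤ expRank p F P + gain p F e P - 1 := by
  have h1 : expRank p (link F e) P + 1 = setExp p
      fun X => (famRank (link F e) (X ∩ P) : ℝ) + 1 := by
    rw [setExp_add, setExp_const, expRank]
  have h2 := setExp_mono hp (g := fun X => (famRank (link F e) (X ∩ P) : ℝ) + 1)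
    (h := fun X => (famRank F (insert e (X ∩ P)) : ℝ))
    fun X => by exact_mod_cast famRank_link_succ_le h (X ∩ P)
  rw [gain]
  linarith

/-! ### Random walks down a tree -/

/-- The expectation of `h A P` over a random leaf, where `P` collects the elements visited and `A`
those whose `Yes` arc was taken, starting from given sets. -/
def walkExp (p : Fin n → ℝ) (h : Finset (Fin n) → Finset (Fin n) → ℝ) :
    DecisionTree n → Finset (Fin n) → Finset (Fin n) → ℝ
  | .leaf, A, P => h A P
  | .node e t₁ t₀, A, P =>
    p e * walkExp p h t₁ (insert e A) (insert e P) + (1 - p e) * walkExp p h t₀ A (insert e P)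

/-- The elements represented in a tree. -/
def elts : DecisionTree n → Finset (Fin n)
  | .leaf => ∅
  | .node e t₁ t₀ => insert e (elts t₁ ∪ elts t₀)

/-- No element represented at a node is represented again below it. -/
def ReadOnce : DecisionTree n → Prop
  | .leaf => True
  | .node e t₁ t₀ => e ∉ elts t₁ ∧ e ∉ elts t₀ ∧ ReadOnce t₁ ∧ ReadOnce t₀

/-- The tree that stops when it would query `w`. -/
def cut (w : Fin n) : DecisionTree n → DecisionTree n
  | .leaf => .leaf
  | .node e t₁ t₀ => if e = w then .leaf else .node e (cut w t₁) (cut w t₀)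

theorem elts_cut_subset (w : Fin n) (T : DecisionTree n) : elts (cut w T) ⊆ elts T := by
  induction T with
  | leaf => exact Subset.rfl
  | node e t₁ t₀ h₁ h₀ =>
    rw [cut]
    split_ifs
    · exact empty_subset _
    · exact insert_subset_insert _ (union_subset_union h₁ h₀)

theorem ReadOnce.cut (w : Fin n) {T : DecisionTree n} (h : ReadOnce T) : ReadOnce (cut w T) := by
  induction T with
  | leaf => trivial
  | node e t₁ t₀ h₁ h₀ =>
    rw [DecisionTree.cut]
    split_ifs
    · trivial
    · exact ⟨fun he => h.1 (elts_cut_subset w t₁ he), fun he => h.2.1 (elts_cut_subset w t₀ he),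
        h₁ h.2.2.1, h₀ h.2.2.2⟩

theorem walkExp_nonneg {p : Fin n → ℝ} (hp : ∀ i, 0 ≤ p i ∧ p i ≤ 1)
    {h : Finset (Fin n) → Finset (Fin n) → ℝ} (hh : ∀ A P, 0 ≤ h A P) (T : DecisionTree n)
    (A P : Finset (Fin n)) : 0 ≤ walkExp p h T A P := by
  induction T generalizing A P with
  | leaf => exact hh A P
  | node e t₁ t₀ h₁ h₀ =>
    exact add_nonneg (mul_nonneg (hp e).1 (h₁ _ _))
      (mul_nonneg (sub_nonneg.2 (hp e).2) (h₀ _ _))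

/-! ### The exponential potential along the walk -/

/-- The exponential potential of a state of the walk. -/
noncomputable def potential (p : Fin n → ℝ) (α β : ℝ) (F : Finset (Finset (Fin n)))
    (A P : Finset (Fin n)) : ℝ :=
  Real.exp (α * famRank F A - β * expRank p F P)

theorem potential_nonneg (p : Fin n → ℝ) (α β : ℝ) (F : Finset (Finset (Fin n)))
    (A P : Finset (Fin n)) : 0 ≤ potential p α β F A P :=
  (Real.exp_pos _).le

/-- The rank of A contributes at most a factor 1 + p(exp α − 1) on average. The β-term contributes
exp(−βpg) with g ≥ 1/2, and βg ≥ exp α − 1. -/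
theorem potential_step_of_half_le_gain {p : Fin n → ℝ} (hp : ∀ i, 0 ≤ p i ∧ p i ≤ 1) {α β : ℝ}
    (hα : 0 ≤ α) (hβ : 2 * (Real.exp α - 1) ≤ β) (F : Finset (Finset (Fin n))) {e : Fin n}
    {P : Finset (Fin n)} (A : Finset (Fin n)) (he : e ∉ P) (hg : 1 / 2 ≤ gain p F e P) :
    p e * potential p α β F (insert e A) (insert e P) +
      (1 - p e) * potential p α β F A (insert e P) ≤ potential p α β F A P := by
  obtain ⟨h0, h1⟩ := hp e
  have hy : 0 ≤ Real.exp α - 1 := sub_nonneg.2 (Real.one_le_exp hα)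
  have hf : (famRank F (insert e A) : ℝ) ≤ famRank F A + 1 := by
    exact_mod_cast famRank_insert_le_succ F e A
  have hA : potential p α β F (insert e A) (insert e P) ≤
      Real.exp α * potential p α β F A (insert e P) := by
    rw [potential, potential, ← Real.exp_add]
    refine Real.exp_le_exp.2 ?_
    nlinarith [mul_le_mul_of_nonneg_left hf hα]
  have hP : potential p α β F A (insert e P) =
      potential p α β F A P * Real.exp (-(β * (p e * gain p F e P))) := by
    rw [potential, potential, ← Real.exp_add, expRank_insert p F he]
    congr 1
    ring
  have hb : p e * (Real.exp α - 1) ≤ β * (p e * gain p F e P) := by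
    have : Real.exp α - 1 ≤ β * gain p F e P := by
      nlinarith [mul_le_mul_of_nonneg_left hg (by linarith : (0 : ℝ) ≤ β)]
    nlinarith [mul_le_mul_of_nonneg_left this h0]
  have hc : (p e * Real.exp α + (1 - p e)) * Real.exp (-(β * (p e * gain p F e P))) ≤ 1 := by
    have h2 : p e * Real.exp α + (1 - p e) ≤ Real.exp (β * (p e * gain p F e P)) := by
      have := Real.add_one_le_exp (β * (p e * gain p F e P))
      linarith
    calc _ ≤ Real.exp (β * (p e * gain p F e P)) * Real.exp (-(β * (p e * gain p F e P))) :=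
          mul_le_mul_of_nonneg_right h2 (Real.exp_pos _).le
      _ = 1 := by rw [← Real.exp_add, add_neg_cancel, Real.exp_zero]
  calc _ ≤ p e * (Real.exp α * potential p α β F A (insert e P)) +
        (1 - p e) * potential p α β F A (insert e P) := by gcongr
    _ = potential p α β F A P *
        ((p e * Real.exp α + (1 - p e)) * Real.exp (-(β * (p e * gain p F e P)))) := by
      rw [hP]
      ring
    _ ≤ potential p α β F A P := mul_le_of_le_one_right (potential_nonneg _ _ _ _ _ _) hc

theorem potential_step_of_gain_lt_half {p : Fin n → ℝ} (hp : ∀ i, 0 ≤ p i ∧ p i ≤ 1) {α β : ℝ}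
    (hα : 0 ≤ α) (hβ : 0 ≤ β) (F : Finset (Finset (Fin n))) {e : Fin n}
    {P : Finset (Fin n)} (A : Finset (Fin n)) (he : e ∉ P) (hg : gain p F e P < 1 / 2) :
    p e * potential p α β F (insert e A) (insert e P) +
      (1 - p e) * potential p α β F A (insert e P) ≤
      potential p α β F A P + Real.exp (α - β / 2) * potential p α β (link F e) A P := by
  obtain ⟨h0, h1⟩ := hp e
  have hL : 0 ≤ Real.exp (α - β / 2) * potential p α β (link F e) A P :=
    mul_nonneg (Real.exp_pos _).le (potential_nonneg _ _ _ _ _ _)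
  have hG : expRank p F P ≤ expRank p F (insert e P) := by
    rw [expRank_insert p F he]
    exact le_add_of_nonneg_right (mul_nonneg h0 (gain_nonneg hp F e P))
  have hno : potential p α β F A (insert e P) ≤ potential p α β F A P :=
    Real.exp_le_exp.2 (by nlinarith [mul_le_mul_of_nonneg_left hG hβ])
  have hyes : potential p α β F (insert e A) (insert e P) ≤
      potential p α β F A P + Real.exp (α - β / 2) * potential p α β (link F e) A P := by
    by_cases hcov : ∃ S ∈ F, e ∈ S
    · rcases le_max_iff.1 (famRank_insert_le_max F e A) with hr | hr
      · refine le_add_of_le_of_nonneg (Real.exp_le_exp.2 ?_) hL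
        have hr' : (famRank F (insert e A) : ℝ) ≤ famRank F A := by exact_mod_cast hr
        nlinarith [mul_le_mul_of_nonneg_left hG hβ, mul_le_mul_of_nonneg_left hr' hα]
      · refine le_add_of_nonneg_of_le (potential_nonneg _ _ _ _ _ _) ?_
        rw [potential, potential, ← Real.exp_add]
        refine Real.exp_le_exp.2 ?_
        have hr' : (famRank F (insert e A) : ℝ) ≤ famRank (link F e) A + 1 := by exact_mod_cast hr
        have hl : expRank p (link F e) P ≤ expRank p F (insert e P) - 1 / 2 := by
          linarith [expRank_link_le hp hcov P]
        nlinarith [mul_le_mul_of_nonneg_left hl hβ, mul_le_mul_of_nonneg_left hr' hα]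
    · push Not at hcov
      refine le_add_of_le_of_nonneg (Real.exp_le_exp.2 ?_) hL
      have hr' : (famRank F (insert e A) : ℝ) ≤ famRank F A := by
        exact_mod_cast famRank_insert_of_not_covered hcov A
      nlinarith [mul_le_mul_of_nonneg_left hG hβ, mul_le_mul_of_nonneg_left hr' hα]
  -- Only the Yes arc incurs the link term; its factor p e ≤ 1 is dropped.
  nlinarith [mul_le_mul_of_nonneg_left hyes h0,
    mul_le_mul_of_nonneg_left hno (sub_nonneg.2 h1), mul_nonneg (sub_nonneg.2 h1) hL]

/-- The loss at a query of w is a link potential at the state just before that query, where a walk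
in `cut w T` stops. Indexing by elements rather than nodes is what bounds the number of terms by n.
-/
theorem walkExp_potential_le {p : Fin n → ℝ} (hp : ∀ i, 0 ≤ p i ∧ p i ≤ 1) {α β : ℝ}
    (hα : 0 ≤ α) (hβ : 2 * (Real.exp α - 1) ≤ β) (F : Finset (Finset (Fin n)))
    {T : DecisionTree n} (hT : ReadOnce T) (A P : Finset (Fin n)) (hP : Disjoint (elts T) P) :
    walkExp p (potential p α β F) T A P ≤ potential p α β F A P +
      ∑ w ∈ elts T, Real.exp (α - β / 2) *
        walkExp p (potential p α β (link F w)) (cut w T) A P := by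
  induction T generalizing A P with
  | leaf => simp [walkExp, elts]
  | node e t₁ t₀ ih₁ ih₀ =>
    obtain ⟨he₁, he₀, hT₁, hT₀⟩ := hT
    obtain ⟨h0, h1⟩ := hp e
    rw [elts, disjoint_insert_left, disjoint_union_left] at hP
    obtain ⟨heP, hP₁, hP₀⟩ := hP
    have hβ0 : 0 ≤ β := by linarith [Real.one_le_exp hα]
    have hnn : ∀ (w : Fin n) (t : DecisionTree n) (A P : Finset (Fin n)),
        0 ≤ Real.exp (α - β / 2) * walkExp p (potential p α β (link F w)) (cut w t) A P :=
      fun w t A P => mul_nonneg (Real.exp_pos _).le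
        (walkExp_nonneg hp (potential_nonneg p α β (link F w)) _ _ _)
    -- Both sums are enlarged to the same index set by nonnegative terms, so that they can be
    -- averaged termwise.
    have i₁ := (ih₁ hT₁ (insert e A) (insert e P) (disjoint_insert_right.2 ⟨he₁, hP₁⟩)).trans
      (add_le_add le_rfl (sum_le_sum_of_subset_of_nonneg
        (subset_union_left (s₂ := elts t₀)) fun w _ _ => hnn w t₁ _ _))
    have i₀ := (ih₀ hT₀ A (insert e P) (disjoint_insert_right.2 ⟨he₀, hP₀⟩)).trans
      (add_le_add le_rfl (sum_le_sum_of_subset_of_nonneg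
        (subset_union_right (s₁ := elts t₁)) fun w _ _ => hnn w t₀ _ _))
    have heU : e ∉ elts t₁ ∪ elts t₀ := by simp [he₁, he₀]
    have hsum : ∑ w ∈ elts t₁ ∪ elts t₀, Real.exp (α - β / 2) *
          walkExp p (potential p α β (link F w)) (cut w (.node e t₁ t₀)) A P =
        p e * (∑ w ∈ elts t₁ ∪ elts t₀, Real.exp (α - β / 2) *
          walkExp p (potential p α β (link F w)) (cut w t₁) (insert e A) (insert e P)) +
        (1 - p e) * (∑ w ∈ elts t₁ ∪ elts t₀, Real.exp (α - β / 2) *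
          walkExp p (potential p α β (link F w)) (cut w t₀) A (insert e P)) := by
      rw [mul_sum, mul_sum, ← sum_add_distrib]
      refine sum_congr rfl fun w hw => ?_
      have hne : e ≠ w := fun h => heU (h ▸ hw)
      rw [cut, if_neg hne, walkExp]
      ring
    have hstep : p e * potential p α β F (insert e A) (insert e P) +
        (1 - p e) * potential p α β F A (insert e P) ≤
        potential p α β F A P + Real.exp (α - β / 2) * potential p α β (link F e) A P := by
      rcases le_or_gt (1 / 2) (gain p F e P) with hg | hg
      · exact (potential_step_of_half_le_gain hp hα hβ F A heP hg).trans
          (le_add_of_nonneg_right (mul_nonneg (Real.exp_pos _).le (potential_nonneg _ _ _ _ _ _)))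
      · exact potential_step_of_gain_lt_half hp hα hβ0 F A heP hg
    rw [elts, sum_insert heU, hsum, walkExp]
    -- Cutting at e stops at the root: the term w = e is exactly the extra term of `hstep`.
    have hcut : walkExp p (potential p α β (link F e)) (cut e (.node e t₁ t₀)) A P =
        potential p α β (link F e) A P := by
      rw [cut, if_pos rfl, walkExp]
    rw [hcut]
    have j₁ := mul_le_mul_of_nonneg_left i₁ h0
    have j₀ := mul_le_mul_of_nonneg_left i₀ (sub_nonneg.2 h1)
    rw [mul_add] at j₁ j₀
    linarith

theorem walkExp_const (p : Fin n → ℝ) (c : ℝ) (T : DecisionTree n) (A P : Finset (Fin n)) :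
    walkExp p (fun _ _ => c) T A P = c := by
  induction T generalizing A P with
  | leaf => rfl
  | node e t₁ t₀ h₁ h₀ =>
    rw [walkExp, h₁, h₀]
    ring

theorem potential_eq_one_of_famRank_eq_zero (p : Fin n → ℝ) (α β : ℝ)
    {F : Finset (Finset (Fin n))} (h : ∀ X, famRank F X = 0) :
    potential p α β F = fun _ _ => 1 := by
  funext A P
  simp [potential, expRank, h, setExp]

/-- The at most n link terms are each at most 2 exp(α − β/2) by induction, hence total at most 1.
The bound 2 thus reproduces itself and does not depend on d. -/
theorem walkExp_potential_le_two {p : Fin n → ℝ} (hp : ∀ i, 0 ≤ p i ∧ p i ≤ 1) {α β : ℝ}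
    (hα : 0 ≤ α) (hβ : 2 * (Real.exp α - 1) ≤ β) (hn : 2 * n * Real.exp (α - β / 2) ≤ 1)
    (d : ℕ) (F : Finset (Finset (Fin n))) (hF : ∀ S ∈ F, S.card ≤ d)
    {T : DecisionTree n} (hT : ReadOnce T) :
    walkExp p (potential p α β F) T ∅ ∅ ≤ 2 := by
  induction d generalizing F T with
  | zero =>
    have h0 : ∀ X, famRank F X = 0 := fun X => Nat.le_zero.1 <| Finset.sup_le fun S hS =>
      (card_le_card inter_subset_left).trans (hF S hS)
    rw [potential_eq_one_of_famRank_eq_zero p α β h0, walkExp_const]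
    norm_num
  | succ d ih =>
    have hlink : ∀ w, ∀ S ∈ link F w, S.card ≤ d := by
      intro w S hS
      obtain ⟨S', hS', rfl⟩ := mem_image.1 hS
      obtain ⟨hF', hw⟩ := mem_filter.1 hS'
      rw [card_erase_of_mem hw]
      exact Nat.sub_le_of_le_add (hF S' hF')
    refine (walkExp_potential_le hp hα hβ F hT ∅ ∅ (disjoint_empty_right _)).trans ?_
    have hone : potential p α β F ∅ ∅ = 1 := by
      simp [potential, famRank_empty, expRank_empty]
    have hsum : ∑ w ∈ elts T, Real.exp (α - β / 2) *
        walkExp p (potential p α β (link F w)) (cut w T) ∅ ∅ ≤ 1 := by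
      calc _ ≤ ∑ _w ∈ elts T, Real.exp (α - β / 2) * 2 :=
            sum_le_sum fun w _ => mul_le_mul_of_nonneg_left (ih (link F w) (hlink w) (hT.cut w))
              (Real.exp_pos _).le
        _ = (elts T).card * (Real.exp (α - β / 2) * 2) := by rw [sum_const, nsmul_eq_mul]
        _ ≤ n * (Real.exp (α - β / 2) * 2) := by
            gcongr
            simpa using card_le_univ (elts T)
        _ ≤ 1 := by linarith
    linarith

/-! ### Random leaves as random walks -/

theorem sum_leaf_node (e : Fin n) (t₁ t₀ : DecisionTree n) (g : Leaf (.node e t₁ t₀) → ℝ) :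
    ∑ l, g l = ∑ l : Leaf t₁, g (.yes l) + ∑ l : Leaf t₀, g (.no l) := by
  let E : Leaf t₁ ⊕ Leaf t₀ ≃ Leaf (.node e t₁ t₀) :=
    { toFun := Sum.elim Leaf.yes Leaf.no
      invFun := fun l => match l with
        | .yes l => Sum.inl l
        | .no l => Sum.inr l
      left_inv := by rintro (l | l) <;> rfl
      right_inv := by intro l; cases l <;> rfl }
  rw [← E.sum_comp, Fintype.sum_sum_type]
  rfl

theorem leafExp_node (p : Fin n → ℝ) (e : Fin n) (t₁ t₀ : DecisionTree n)
    (g : Leaf (.node e t₁ t₀) → ℝ) :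
    leafExp p g = p e * leafExp p (fun l => g (.yes l)) +
      (1 - p e) * leafExp p (fun l => g (.no l)) := by
  simp only [leafExp, sum_leaf_node, leafProb, mul_sum, mul_assoc]

theorem eltSet_image_inYes {e : Fin n} {t₁ t₀ : DecisionTree n} (S : Finset (Node t₁)) :
    eltSet (S.image (Node.inYes (e := e) (t₀ := t₀))) = eltSet S := by
  rw [eltSet, eltSet, image_image]
  rfl

theorem eltSet_image_inNo {e : Fin n} {t₁ t₀ : DecisionTree n} (S : Finset (Node t₀)) :
    eltSet (S.image (Node.inNo (e := e) (t₁ := t₁))) = eltSet S := by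
  rw [eltSet, eltSet, image_image]
  rfl

theorem eltSet_insert {T : DecisionTree n} (v : Node T) (S : Finset (Node T)) :
    eltSet (insert v S) = insert (elt v) (eltSet S) :=
  image_insert _ _ _

theorem walkExp_eq_leafExp (p : Fin n → ℝ) (h : Finset (Fin n) → Finset (Fin n) → ℝ)
    (T : DecisionTree n) (A P : Finset (Fin n)) :
    walkExp p h T A P =
      leafExp p fun l : Leaf T => h (A ∪ eltSet (active l)) (P ∪ eltSet (path l)) := by
  induction T generalizing A P with
  | leaf =>
    have : ∀ g : Leaf (.leaf : DecisionTree n) → ℝ, ∑ l, g l = g .here := fun g =>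
      Finset.sum_singleton g _
    simp [walkExp, leafExp, this, leafProb, active, path, eltSet]
  | node e t₁ t₀ h₁ h₀ =>
    rw [walkExp, leafExp_node, h₁, h₀]
    simp only [active, path, eltSet_insert, eltSet_image_inYes, eltSet_image_inNo, elt,
      insert_union, union_insert]

theorem leafProb_nonneg {p : Fin n → ℝ} (hp : ∀ i, 0 ≤ p i ∧ p i ≤ 1) {T : DecisionTree n}
    (l : Leaf T) : 0 ≤ leafProb p l := by
  induction l with
  | here => exact zero_le_one
  | yes l ih => exact mul_nonneg (hp _).1 ih
  | no l ih => exact mul_nonneg (sub_nonneg.2 (hp _).2) ih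

theorem leafExp_mono {p : Fin n → ℝ} (hp : ∀ i, 0 ≤ p i ∧ p i ≤ 1) {T : DecisionTree n}
    {g h : Leaf T → ℝ} (hgh : ∀ l, g l ≤ h l) : leafExp p g ≤ leafExp p h :=
  sum_le_sum fun l _ => mul_le_mul_of_nonneg_left (hgh l) (leafProb_nonneg hp l)

theorem leafExp_const (p : Fin n → ℝ) (T : DecisionTree n) (c : ℝ) :
    leafExp p (fun _ : Leaf T => c) = c := by
  rw [← walkExp_eq_leafExp p (fun _ _ => c) T ∅ ∅, walkExp_const]

theorem active_subset_path {T : DecisionTree n} (l : Leaf T) : active l ⊆ path l := by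
  induction l with
  | here => exact Subset.rfl
  | yes l ih => exact insert_subset_insert _ (image_subset_image ih)
  | no l ih => exact (image_subset_image ih).trans (subset_insert _ _)

theorem exists_leaf_mem_path {T : DecisionTree n} {w : Fin n} (hw : w ∈ elts T) :
    ∃ l : Leaf T, ∃ v ∈ path l, elt v = w := by
  induction T with
  | leaf => simp [elts] at hw
  | node e t₁ t₀ h₁ h₀ =>
    have hl : ∀ t : DecisionTree n, Nonempty (Leaf t) := fun t => by
      induction t with
      | leaf => exact ⟨.here⟩
      | node e t₁ t₀ h₁ h₀ => exact h₁.map .yes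
    rw [elts, mem_insert, mem_union] at hw
    rcases hw with rfl | hw | hw
    · obtain ⟨l⟩ := hl t₁
      exact ⟨.yes l, .root, mem_insert_self _ _, rfl⟩
    · obtain ⟨l, v, hv, rfl⟩ := h₁ hw
      exact ⟨.yes l, .inYes v, mem_insert_of_mem (mem_image_of_mem _ hv), rfl⟩
    · obtain ⟨l, v, hv, rfl⟩ := h₀ hw
      exact ⟨.no l, .inNo v, mem_insert_of_mem (mem_image_of_mem _ hv), rfl⟩

theorem PathsDistinct.readOnce {T : DecisionTree n} (h : PathsDistinct T) : ReadOnce T := by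
  induction T with
  | leaf => trivial
  | node e t₁ t₀ h₁ h₀ =>
    refine ⟨fun he => ?_, fun he => ?_, h₁ fun l u hu v hv huv => ?_, h₀ fun l u hu v hv huv => ?_⟩
    · obtain ⟨l, v, hv, hve⟩ := exists_leaf_mem_path he
      cases h (.yes l) .root (mem_insert_self _ _) (.inYes v)
        (mem_insert_of_mem (mem_image_of_mem _ hv)) hve.symm
    · obtain ⟨l, v, hv, hve⟩ := exists_leaf_mem_path he
      cases h (.no l) .root (mem_insert_self _ _) (.inNo v)
        (mem_insert_of_mem (mem_image_of_mem _ hv)) hve.symm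
    · exact Node.inYes.inj (h (.yes l) (.inYes u) (mem_insert_of_mem (mem_image_of_mem _ hu))
        (.inYes v) (mem_insert_of_mem (mem_image_of_mem _ hv)) huv)
    · exact Node.inNo.inj (h (.no l) (.inNo u) (mem_insert_of_mem (mem_image_of_mem _ hu))
        (.inNo v) (mem_insert_of_mem (mem_image_of_mem _ hv)) huv)

theorem eltSet_nodesOf_inter {T : DecisionTree n} (X : Finset (Fin n)) (S : Finset (Node T)) :
    eltSet (nodesOf T X ∩ S) = X ∩ eltSet S := by
  ext x
  simp only [eltSet, nodesOf, mem_image, mem_inter, mem_filter, mem_univ, true_and]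
  constructor
  · rintro ⟨v, ⟨hX, hS⟩, rfl⟩
    exact ⟨hX, v, hS, rfl⟩
  · rintro ⟨hX, v, hS, rfl⟩
    exact ⟨v, ⟨hX, hS⟩, rfl⟩

/-! ### The adaptivity gap -/

theorem fXos_eq_famRank {T : DecisionTree n} (A' : Leaf T → Finset (Node T)) (X : Finset (Fin n)) :
    fXos A' X = famRank (univ.image fun l => eltSet (A' l)) X := by
  rw [fXos, famRank, sup_image]
  rfl

theorem nadp_fXos {p : Fin n → ℝ} {T : DecisionTree n} (A' : Leaf T → Finset (Node T)) :
    nadp p T (fun S => (fXos A' S : ℝ)) =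
      leafExp p fun l : Leaf T =>
        expRank p (univ.image fun l => eltSet (A' l)) (eltSet (path l)) := by
  simp only [nadp, nodeSetExp, eltSet_nodesOf_inter, fXos_eq_famRank, expRank, setExp]

/-- The set of ℓ itself is a candidate in the maximum, and distinct nodes on its path have distinct
elements. -/
theorem card_le_famRank_active {T : DecisionTree n} (hT : PathsDistinct T)
    {A' : Leaf T → Finset (Node T)} (hA : ∀ l, A' l ⊆ active l) (l : Leaf T) :
    (A' l).card ≤ famRank (univ.image fun l => eltSet (A' l)) (eltSet (active l)) := by
  have hinj : (eltSet (A' l)).card = (A' l).card :=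
    card_image_of_injOn fun u hu v hv huv =>
      hT l u (active_subset_path l (hA l hu)) v (active_subset_path l (hA l hv)) huv
  have hsub : eltSet (A' l) ⊆ eltSet (active l) := image_subset_image (hA l)
  have := card_inter_le_famRank (F := univ.image fun l => eltSet (A' l))
    (mem_image_of_mem (fun l => eltSet (A' l)) (mem_univ l)) (eltSet (active l))
  rwa [inter_eq_left.2 hsub, hinj] at this

/-- The non-adaptive reward is at least about `α / β` times the adaptive one. -/
theorem mul_leafExp_card_le {p : Fin n → ℝ} (hp : ∀ i, 0 ≤ p i ∧ p i ≤ 1) {α β : ℝ}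
    (hα : 0 ≤ α) (hβ : 2 * (Real.exp α - 1) ≤ β) (hn : 2 * n * Real.exp (α - β / 2) ≤ 1)
    {T : DecisionTree n} (hT : PathsDistinct T)
    {A' : Leaf T → Finset (Node T)} (hA : ∀ l, A' l ⊆ active l) :
    α * leafExp p (fun l => ((A' l).card : ℝ)) ≤
      β * nadp p T (fun S => (fXos A' S : ℝ)) + 1 := by
  set F := univ.image fun l => eltSet (A' l) with hF
  have h2 := walkExp_potential_le_two hp hα hβ hn n F
    (fun S _ => by simpa using card_le_univ S) hT.readOnce
  rw [walkExp_eq_leafExp] at h2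
  have hle : leafExp p (fun l : Leaf T => α * ((A' l).card : ℝ)
      - β * expRank p F (eltSet (path l)) + 1) ≤ 2 := by
    refine (leafExp_mono hp fun l => ?_).trans h2
    have hc : ((A' l).card : ℝ) ≤ famRank F (eltSet (active l)) := by
      exact_mod_cast card_le_famRank_active hT hA l
    rw [empty_union, empty_union, potential]
    -- exp y ≥ 1 + y turns the exponential bound into a linear one.
    linarith [Real.add_one_le_exp (α * famRank F (eltSet (active l))
      - β * expRank p F (eltSet (path l))), mul_le_mul_of_nonneg_left hc hα]
  have hlin : leafExp p (fun l : Leaf T => α * ((A' l).card : ℝ)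
      - β * expRank p F (eltSet (path l)) + 1) =
      α * leafExp p (fun l => ((A' l).card : ℝ)) -
        β * leafExp p (fun l : Leaf T => expRank p F (eltSet (path l))) + 1 := by
    rw [← leafExp_const p T 1]
    simp only [leafExp, mul_sum, ← sum_add_distrib, ← sum_sub_distrib]
    refine sum_congr rfl fun l _ => ?_
    have := leafExp_const p T 1
    rw [leafExp] at this
    rw [this]
    ring
  rw [nadp_fXos, ← hF]
  linarith

end DecisionTree

/-! ### Choice of parameters -/

theorem mul_log_le_probingK_mul {n : ℕ} (hn : 3 ≤ Real.log n) :
    25 * Real.log n ≤ probingK n * Real.log (Real.log n) := by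
  have hα : 1 ≤ Real.log (Real.log n) := by
    rw [Real.le_log_iff_exp_le (by linarith)]
    linarith [Real.exp_one_lt_d9]
  have h2 : 0 < Real.log 2 := Real.log_pos one_lt_two
  have hneg : Real.log (Real.log 2) < 0 :=
    Real.log_neg h2 (by linarith [Real.log_two_lt_d9])
  have hge : -1 ≤ Real.log (Real.log 2) := by
    rw [Real.le_log_iff_exp_le h2]
    linarith [Real.exp_neg_one_lt_d9, Real.log_two_gt_d9]
  have hr : Real.logb 2 n / Real.logb 2 (Real.logb 2 n) =
      Real.log n / (Real.log (Real.log n) - Real.log (Real.log 2)) := by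
    rw [Real.logb, Real.logb, Real.log_div (by linarith) h2.ne', div_div_div_cancel_right₀ h2.ne']
  have hc := Nat.le_ceil (Real.logb 2 n / Real.logb 2 (Real.logb 2 n))
  -- Passing to natural logarithms adds −ln ln 2 ≤ 1 ≤ ln ln n to the denominator, at most doubling
  -- it; hence 25 from 50.
  have hlow : Real.log n / (2 * Real.log (Real.log n)) ≤
      Real.log n / (Real.log (Real.log n) - Real.log (Real.log 2)) :=
    div_le_div_of_nonneg_left (by linarith) (by linarith) (by linarith)
  have hK : 50 * (Real.log n / (2 * Real.log (Real.log n))) ≤ probingK n := by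
    rw [probingK]
    push_cast
    linarith [hr ▸ hc]
  calc 25 * Real.log n
      = 50 * (Real.log n / (2 * Real.log (Real.log n))) * Real.log (Real.log n) := by
        field_simp
        norm_num
    _ ≤ _ := mul_le_mul_of_nonneg_right hK (by linarith)

theorem mainTheorem8 :
    ∃ N : ℕ, ∀ n : ℕ, N ≤ n →
      ∀ (p : Fin n → ℝ), (∀ i, 0 ≤ p i ∧ p i ≤ 1) →
      ∀ (T : DecisionTree n), T.PathsDistinct →
      ∀ (A' : DecisionTree.Leaf T → Finset (DecisionTree.Node T)),
        (∀ l, A' l ⊆ DecisionTree.active l) →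
        6 * (probingK n : ℝ) ≤ DecisionTree.leafExp p (fun l => ((A' l).card : ℝ)) →
        1 / (6 * (probingK n : ℝ)) * DecisionTree.leafExp p (fun l => ((A' l).card : ℝ))
          ≤ DecisionTree.nadp p T (fun S => (DecisionTree.fXos A' S : ℝ)) := by
  -- 27 = 3³ > e³ ensures ln n ≥ 3 > e, hence ln ln n ≥ 1.
  refine ⟨27, fun n hn p hp T hT A' hA hW => ?_⟩
  have hn' : (27 : ℝ) ≤ n := by exact_mod_cast hn
  have hx : 3 ≤ Real.log n := by
    rw [Real.le_log_iff_exp_le (by linarith)]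
    have h3 : Real.exp 3 = Real.exp 1 ^ 3 := by rw [← Real.exp_nat_mul]; norm_num
    have h27 : Real.exp 1 ^ 3 ≤ 3 ^ 3 :=
      pow_le_pow_left₀ (Real.exp_pos _).le (by linarith [Real.exp_one_lt_d9]) 3
    linarith
  have hKx := mul_log_le_probingK_mul hx
  have hK : (50 : ℝ) ≤ probingK n := by
    rw [probingK]
    push_cast
    linarith [Nat.cast_nonneg (α := ℝ) ⌈Real.logb 2 n / Real.logb 2 (Real.logb 2 n)⌉₊]
  have hexp : Real.exp (Real.log (Real.log n)) = Real.log n := Real.exp_log (by linarith)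
  have hα : 1 ≤ Real.log (Real.log n) := by
    rw [Real.le_log_iff_exp_le (by linarith)]
    linarith [Real.exp_one_lt_d9]
  have hαx : Real.log (Real.log n) ≤ Real.log n - 1 := Real.log_le_sub_one_of_pos (by linarith)
  set x := Real.log n with hxdef
  set α := Real.log x
  set W := DecisionTree.leafExp p (fun l => ((A' l).card : ℝ))
  set K : ℝ := (probingK n : ℝ)
  -- This β makes exp(α − β/2) exactly 1/(2n), and exp α = x makes the other condition 2(x − 1) ≤ β.
  have hgap := DecisionTree.mul_leafExp_card_le hp (α := α) (β := 2 * (Real.log 2 + x + α))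
    (by linarith) (by rw [hexp]; linarith [Real.log_pos one_lt_two]) (by
      have h1 : α - 2 * (Real.log 2 + x + α) / 2 = -(Real.log 2 + x) := by ring
      rw [h1, Real.exp_neg, Real.exp_add, Real.exp_log two_pos, hxdef,
        Real.exp_log (by linarith)]
      exact (mul_inv_cancel₀ (by linarith)).le) hT hA
  set V := DecisionTree.nadp p T (fun S => (DecisionTree.fXos A' S : ℝ))
  have hW0 : 300 ≤ W := by linarith
  have hβ : 2 * (Real.log 2 + x + α) ≤ 6 * x := by linarith [Real.log_two_lt_d9]
  have hβ0 : 0 < 2 * (Real.log 2 + x + α) := by linarith [Real.log_pos one_lt_two]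
  -- The additive 1 is absorbed in half of αW ≥ 300; the lower bound on W serves only to make W
  -- large.
  have hV : α * W / 2 ≤ 2 * (Real.log 2 + x + α) * V := by nlinarith
  have hV0 : 0 ≤ V := by
    by_contra h
    push Not at h
    nlinarith [mul_neg_of_pos_of_neg hβ0 h, mul_pos (by linarith : 0 < α) (by linarith : 0 < W)]
  have hV6 : α * W / 2 ≤ 6 * x * V := hV.trans (mul_le_mul_of_nonneg_right hβ hV0)
  rw [one_div, inv_mul_le_iff₀ (by linarith)]
  have hαK : 25 * x * V ≤ K * α * V := mul_le_mul_of_nonneg_right hKx hV0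
  -- αW ≤ 12xV, while 6KαV ≥ 150xV.
  have : α * W ≤ α * (6 * K * V) := by nlinarith [mul_nonneg (by linarith : 0 ≤ x) hV0]
  exact le_of_mul_le_mul_left this (by linarith)
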